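/- Let $\mathbb{A}\subseteq\mathbb{C}$ be the field of complex algebraic numbers, let $d\in\mathbb{N}$, let $A=\mathrm{diag}(\lambda_1,\ldots,\lambda_d)$ be a diagonal matrix with $\lambda_1,\ldots,\lambda_d\in\mathbb{A}$ and $|\lambda_i|=1$ for all $i$, and let $x,y\in\mathbb{A}^d$. Write $\mathcal{O}=\{A^n x : n\in\mathbb{N}\}$ (with $0\in\mathbb{N}$), and let $\overline{\mathcal{O}}$ be its topological closure in $\mathbb{C}^d$. Call a set $\mathcal{P}\subseteq\mathbb{C}^d$ semialgebraic if, under the identification of $\mathbb{C}^d$ with $\mathbb{R}^{2d}$ by real and imaginary parts, it is the set of real solutions of a Boolean combination of polynomial inequalities with integer coefficients. Then there exists a semialgebraic set $\mathcal{P}\subseteq\mathbb{C}^d$ with $A\mathcal{P}\subseteq\mathcal{P}$, $x\in\mathcal{P}$ and $y\notin\mathcal{P}$ if and only if $y\notin\overline{\mathcal{O}}$. -/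

import Mathlib

/-- Semialgebraic subsets of `ℝ^σ`: Boolean combinations of strict polynomial inequalities
`p > 0` with integer coefficients. (`p ≥ 0` is the complement of `-p > 0`, and `p = 0` is the
conjunction of `p ≥ 0` and `-p ≥ 0`.) -/
inductive IsSemialgebraic {σ : Type} : Set (σ → ℝ) → Prop
  | pos (p : MvPolynomial σ ℤ) : IsSemialgebraic {v : σ → ℝ | 0 < MvPolynomial.aeval v p}
  | compl {S : Set (σ → ℝ)} : IsSemialgebraic S → IsSemialgebraic Sᶜ
  | inter {S T : Set (σ → ℝ)} : IsSemialgebraic S → IsSemialgebraic T → IsSemialgebraic (S ∩ T)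
  | union {S T : Set (σ → ℝ)} : IsSemialgebraic S → IsSemialgebraic T → IsSemialgebraic (S ∪ T)

/-- The identification of `ℂ^d` with `ℝ^(2d)` through real and imaginary parts. -/
def realCoords {d : ℕ} (z : Fin d → ℂ) : Fin d ⊕ Fin d → ℝ :=
  Sum.elim (fun i => (z i).re) (fun i => (z i).im)

/-- A subset of `ℂ^d` is semialgebraic if it is so under the identification with `ℝ^(2d)`. -/
def IsComplexSemialgebraic {d : ℕ} (P : Set (Fin d → ℂ)) : Prop :=
  ∃ S : Set (Fin d ⊕ Fin d → ℝ), IsSemialgebraic S ∧ P = realCoords ⁻¹' S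

/-- An instance of the Orbit Problem in dimension `d`: a square matrix and two vectors, with
entries in the field of complex algebraic numbers. -/
structure OrbitInstance (d : ℕ) where
  A : Matrix (Fin d) (Fin d) ℂ
  x : Fin d → ℂ
  y : Fin d → ℂ
  algebraic_A : ∀ i j, IsAlgebraic ℚ (A i j)
  algebraic_x : ∀ i, IsAlgebraic ℚ (x i)
  algebraic_y : ∀ i, IsAlgebraic ℚ (y i)

/-- The orbit `{A ^ n x : n ∈ ℕ}`, with `n = 0` included. -/
def OrbitInstance.orbit {d : ℕ} (ℓ : OrbitInstance d) : Set (Fin d → ℂ) :=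
  Set.range fun n : ℕ => (ℓ.A ^ n).mulVec ℓ.x

/-- A non-reachability invariant: `A P ⊆ P`, `x ∈ P` and `y ∉ P`. -/
structure OrbitInstance.IsInvariant {d : ℕ} (ℓ : OrbitInstance d) (P : Set (Fin d → ℂ)) :
    Prop where
  image_subset : ℓ.A.mulVec '' P ⊆ P
  source_mem : ℓ.x ∈ P
  target_notMem : ℓ.y ∉ P

/-! A diagonal unitary acts as a bijective isometry with bounded, hence recurrent, orbits. An
invariant semialgebraic `P` containing `x` is dense in the orbit closure of `x`, and its relative
frontier there is nowhere dense, so it contains a relatively open piece. A point of the closure can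
be pulled back into that piece; pushing it forward again puts it in `P`
(`IsComplexSemialgebraic.closure_orbit_subset`). Conversely, suppose that all `A`-invariant
monomials in the coordinates and their conjugates agree at `x` and `y`. By Stone–Weierstrass,
averages of any continuous function along the two orbits differ by a null sequence
(`tendsto_average_sub_of_conjMonomial_eq`). The distance to the orbit of `x` violates this if `y` is
outside the closure. So an invariant monomial separates the points, and a rational threshold on its
real or imaginary part defines the invariant. -/

/-! ### Recurrence of bounded isometric orbits. -/

theorem Isometry.iterate {X : Type*} [PseudoEMetricSpace X] {f : X → X} (hf : Isometry f) (n : ℕ) :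
    Isometry f^[n] := by
  induction n with
  | zero => exact isometry_id
  | succ n ih => exact ih.comp hf

open Filter Topology in
/-- Recurrence: a bounded orbit of an isometry of a proper space returns near its starting point at
arbitrarily large times. -/
theorem Isometry.exists_iterate_dist_lt {X : Type*} [MetricSpace X] [ProperSpace X] {f : X → X}
    (hf : Isometry f) {x : X} (hb : Bornology.IsBounded (Set.range fun n : ℕ => f^[n] x))
    (N : ℕ) {ε : ℝ} (hε : 0 < ε) : ∃ k, N ≤ k ∧ dist (f^[k] x) x < ε := by
  obtain ⟨a, -, φ, hφ, ha⟩ := tendsto_subseq_of_bounded hb (x := fun n => f^[n] x)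
    (fun n => Set.mem_range_self n)
  obtain ⟨M, hM⟩ := Metric.cauchySeq_iff.1 ha.cauchySeq ε hε
  -- This index makes the two return times differ by at least `N`; cancelling `f^[φ M]` then brings
  -- the orbit back near `x`.
  have hle : φ M + N ≤ φ (φ M + N + M) := by
    have := hφ.id_le (φ M + N + M)
    simp only [id] at this
    omega
  refine ⟨φ (φ M + N + M) - φ M, by omega, ?_⟩
  have h := hM (φ M + N + M) (by omega) M le_rfl
  have hit : Isometry f^[φ M] := hf.iterate _
  rw [← hit.dist_eq, ← Function.iterate_add_apply]
  rwa [show φ M + (φ (φ M + N + M) - φ M) = φ (φ M + N + M) by omega]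

/-- Points of a bounded orbit closure of an isometry are approached at arbitrarily large times. -/
theorem Isometry.exists_iterate_dist_lt_of_mem_closure {X : Type*} [MetricSpace X] [ProperSpace X]
    {f : X → X} (hf : Isometry f) {x y : X}
    (hb : Bornology.IsBounded (Set.range fun n : ℕ => f^[n] x))
    (hy : y ∈ closure (Set.range fun n : ℕ => f^[n] x))
    (N : ℕ) {ε : ℝ} (hε : 0 < ε) : ∃ k, N ≤ k ∧ dist (f^[k] x) y < ε := by
  obtain ⟨_, ⟨j, rfl⟩, hj⟩ := Metric.mem_closure_iff.1 hy (ε / 2) (by positivity)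
  obtain ⟨k, hk, hkx⟩ := hf.exists_iterate_dist_lt hb N (half_pos hε)
  refine ⟨j + k, by omega, ?_⟩
  have hit : Isometry f^[j] := hf.iterate _
  rw [← hit.dist_eq, ← Function.iterate_add_apply] at hkx
  have := dist_triangle (f^[j + k] x) (f^[j] x) y
  rw [dist_comm] at hj
  linarith

/-- Preimages of points of a bounded orbit closure of a bijective isometry stay in the closure. -/
theorem Isometry.mem_closure_of_iterate_mem_closure {X : Type*} [MetricSpace X] [ProperSpace X]
    {f : X → X} (hf : Isometry f) {x z : X}
    (hb : Bornology.IsBounded (Set.range fun n : ℕ => f^[n] x)) (n : ℕ)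
    (hz : f^[n] z ∈ closure (Set.range fun n : ℕ => f^[n] x)) :
    z ∈ closure (Set.range fun n : ℕ => f^[n] x) := by
  refine Metric.mem_closure_iff.2 fun ε hε => ?_
  obtain ⟨k, hk, hkz⟩ := hf.exists_iterate_dist_lt_of_mem_closure hb hz n hε
  refine ⟨_, ⟨k - n, rfl⟩, ?_⟩
  have hit : Isometry f^[n] := hf.iterate _
  rw [← hit.dist_eq, ← Function.iterate_add_apply, dist_comm, Nat.add_sub_cancel' hk]
  exact hkz

/-- A point outside a bounded orbit closure of an isometry keeps its distance to it. -/
theorem Isometry.infDist_le_infDist_iterate {X : Type*} [MetricSpace X] [ProperSpace X]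
    {f : X → X} (hf : Isometry f) {x : X} (y : X)
    (hb : Bornology.IsBounded (Set.range fun n : ℕ => f^[n] x)) (n : ℕ) :
    Metric.infDist y (Set.range fun n : ℕ => f^[n] x) ≤
      Metric.infDist (f^[n] y) (Set.range fun n : ℕ => f^[n] x) := by
  refine (Metric.le_infDist (Set.range_nonempty _)).2 ?_
  rintro _ ⟨m, rfl⟩
  refine le_of_forall_pos_le_add fun ε hε => ?_
  obtain ⟨k, hk, hkm⟩ := hf.exists_iterate_dist_lt_of_mem_closure hb
    (subset_closure (Set.mem_range_self m)) n hε
  have hit : Isometry f^[n] := hf.iterate _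
  have h1 : Metric.infDist y (Set.range fun n : ℕ => f^[n] x) ≤ dist y (f^[k - n] x) :=
    Metric.infDist_le_dist_of_mem (Set.mem_range_self _)
  rw [← hit.dist_eq, ← Function.iterate_add_apply, Nat.add_sub_cancel' hk] at h1
  have h2 := dist_triangle (f^[n] y) (f^[m] x) (f^[k] x)
  rw [dist_comm (f^[m] x)] at h2
  linarith

/-! ### Semialgebraic sets and orbit closures. -/

/-- The preimage of a semialgebraic set under a continuous map has nowhere dense frontier. -/
theorem IsSemialgebraic.isNowhereDense_frontier_preimage {σ : Type} {S : Set (σ → ℝ)}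
    (hS : IsSemialgebraic S) {X : Type*} [TopologicalSpace X] {g : X → σ → ℝ}
    (hg : Continuous g) : IsNowhereDense (frontier (g ⁻¹' S)) := by
  have key : ∀ {U V : Set X}, IsNowhereDense U → IsNowhereDense V → IsNowhereDense (U ∪ V) := by
    intro U V hU hV
    rw [IsNowhereDense, closure_union,
      interior_union_isClosed_of_interior_empty isClosed_closure hV]
    exact hU
  have mono : ∀ {U V : Set X}, IsNowhereDense V → U ⊆ V → IsNowhereDense U := by
    intro U V hV h
    exact Set.subset_empty_iff.1 ((interior_mono (closure_mono h)).trans_eq hV)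
  induction hS with
  | pos p =>
    have ho : IsOpen (g ⁻¹' {v : σ → ℝ | 0 < MvPolynomial.aeval v p}) := by
      refine IsOpen.preimage hg (isOpen_lt continuous_const ?_)
      simpa only [MvPolynomial.eval_map, MvPolynomial.aeval_def] using
        (MvPolynomial.map (algebraMap ℤ ℝ) p).continuous_eval
    rw [IsNowhereDense, isClosed_frontier.closure_eq, ← frontier_compl]
    exact interior_frontier ho.isClosed_compl
  | compl _ ih => rwa [Set.preimage_compl, frontier_compl]
  | inter _ _ ih1 ih2 =>
    rw [Set.preimage_inter]
    refine mono (key ih1 ih2) ((frontier_inter_subset _ _).trans ?_)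
    exact Set.union_subset_union Set.inter_subset_left Set.inter_subset_right
  | union _ _ ih1 ih2 =>
    rw [Set.preimage_union]
    refine mono (key ih1 ih2) ((frontier_union_subset _ _).trans ?_)
    exact Set.union_subset_union Set.inter_subset_left Set.inter_subset_right

theorem continuous_realCoords {d : ℕ} : Continuous (realCoords (d := d)) := by
  refine continuous_pi ?_
  rintro (i | i)
  · exact Complex.continuous_re.comp (continuous_apply i)
  · exact Complex.continuous_im.comp (continuous_apply i)

/-- A forward-invariant semialgebraic set containing a point contains the whole orbit closure of
that point under a bijective isometry with bounded orbits. -/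
theorem IsComplexSemialgebraic.closure_orbit_subset {d : ℕ} {P : Set (Fin d → ℂ)}
    (hP : IsComplexSemialgebraic P) {f : (Fin d → ℂ) → (Fin d → ℂ)} (hf : Isometry f)
    (hsurj : Function.Surjective f) (hfP : Set.MapsTo f P P) {x : Fin d → ℂ} (hx : x ∈ P)
    (hb : Bornology.IsBounded (Set.range fun n : ℕ => f^[n] x)) :
    closure (Set.range fun n : ℕ => f^[n] x) ⊆ P := by
  intro y hy
  obtain ⟨S, hS, rfl⟩ := hP
  have hmem : ∀ n, f^[n] x ∈ closure (Set.range fun n : ℕ => f^[n] x) := fun n =>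
    subset_closure (Set.mem_range_self n)
  set C := closure (Set.range fun n : ℕ => f^[n] x) with hC
  let Q : Set C := Subtype.val ⁻¹' (realCoords ⁻¹' S)
  have hdense : Dense Q := by
    rintro ⟨z, hz⟩
    refine Metric.mem_closure_iff.2 fun ε hε => ?_
    obtain ⟨_, ⟨n, rfl⟩, hn⟩ := Metric.mem_closure_iff.1 hz ε hε
    exact ⟨⟨f^[n] x, hmem n⟩, hfP.iterate n hx, hn⟩
  have hnd : IsNowhereDense (frontier Q) :=
    hS.isNowhereDense_frontier_preimage (g := fun z : C => realCoords z.1)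
      (continuous_realCoords.comp continuous_subtype_val)
  -- Since `Q` is dense, its frontier is the complement of its interior, so that interior is dense.
  rw [IsNowhereDense, isClosed_frontier.closure_eq, frontier, hdense.closure_eq,
    ← Set.compl_eq_univ_sdiff, interior_compl, Set.compl_empty_iff] at hnd
  obtain ⟨⟨u, hu⟩, huQ⟩ : (interior Q).Nonempty := by
    rw [← closure_nonempty_iff, hnd]
    exact ⟨⟨x, hmem 0⟩, trivial⟩
  obtain ⟨ε, hε, hball⟩ := Metric.isOpen_iff.1 isOpen_interior _ huQ
  obtain ⟨_, ⟨m, rfl⟩, hm⟩ := Metric.mem_closure_iff.1 hu (ε / 2) (half_pos hε)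
  obtain ⟨k, hk, hky⟩ := hf.exists_iterate_dist_lt_of_mem_closure hb hy m (half_pos hε)
  -- `f^[k - m]` carries `f^[m] x` close to `y`, so the preimage `z` of `y` is close to `f^[m] x`,
  -- hence to `u`.
  obtain ⟨z, rfl⟩ := hsurj.iterate (k - m) y
  have hzC : z ∈ C := hf.mem_closure_of_iterate_mem_closure hb _ hy
  have hit : Isometry f^[k - m] := hf.iterate _
  have hdist : dist z u < ε := by
    have hk' : f^[k] x = f^[k - m] (f^[m] x) := by
      rw [← Function.iterate_add_apply, Nat.sub_add_cancel hk]
    rw [hk', hit.dist_eq] at hky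
    have := dist_triangle z (f^[m] x) u
    simp only [dist_comm] at *
    linarith
  have hzQ : (⟨z, hzC⟩ : C) ∈ Q := interior_subset (hball hdist)
  exact hfP.iterate _ hzQ

/-! ### Monomials in coordinates and conjugates. -/

/-- The monomial `∏ wᵢ ^ aᵢ * conj wᵢ ^ bᵢ`. -/
noncomputable def conjMonomial {d : ℕ} (a b : Fin d → ℕ) (w : Fin d → ℂ) : ℂ :=
  ∏ i, w i ^ a i * (starRingEnd ℂ (w i)) ^ b i

theorem conjMonomial_mul {d : ℕ} (a b : Fin d → ℕ) (v w : Fin d → ℂ) :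
    conjMonomial a b (v * w) = conjMonomial a b v * conjMonomial a b w := by
  simp only [conjMonomial, ← Finset.prod_mul_distrib, Pi.mul_apply, map_mul, mul_pow]
  exact Finset.prod_congr rfl fun i _ => by ring

theorem conjMonomial_pow {d : ℕ} (a b : Fin d → ℕ) (v : Fin d → ℂ) (n : ℕ) :
    conjMonomial a b (v ^ n) = conjMonomial a b v ^ n := by
  induction n with
  | zero => simp [conjMonomial]
  | succ n ih => rw [pow_succ, conjMonomial_mul, ih, pow_succ]

theorem conjMonomial_add {d : ℕ} (a b a' b' : Fin d → ℕ) (w : Fin d → ℂ) :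
    conjMonomial (a + a') (b + b') w = conjMonomial a b w * conjMonomial a' b' w := by
  simp only [conjMonomial, ← Finset.prod_mul_distrib, Pi.add_apply, pow_add]
  exact Finset.prod_congr rfl fun i _ => by ring

theorem norm_conjMonomial_of_norm_eq_one {d : ℕ} (a b : Fin d → ℕ) {v : Fin d → ℂ}
    (hv : ∀ i, ‖v i‖ = 1) : ‖conjMonomial a b v‖ = 1 := by
  simp [conjMonomial, hv]

open MvPolynomial in
/-- Real and imaginary parts of a monomial are integer polynomials in the real coordinates. -/
theorem exists_aeval_realCoords_eq_conjMonomial {d : ℕ} (a b : Fin d → ℕ) :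
    ∃ p q : MvPolynomial (Fin d ⊕ Fin d) ℤ, ∀ w : Fin d → ℂ,
      (conjMonomial a b w).re = aeval (realCoords w) p ∧
      (conjMonomial a b w).im = aeval (realCoords w) q := by
  let good : ((Fin d → ℂ) → ℂ) → Prop := fun h =>
    ∃ p q : MvPolynomial (Fin d ⊕ Fin d) ℤ, ∀ w : Fin d → ℂ,
      (h w).re = aeval (realCoords w) p ∧ (h w).im = aeval (realCoords w) q
  have one : good 1 := ⟨1, 0, fun w => by simp⟩
  have mul : ∀ g h, good g → good h → good (g * h) := by
    rintro g h ⟨p, q, hg⟩ ⟨p', q', hh⟩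
    refine ⟨p * p' - q * q', p * q' + q * p', fun w => ?_⟩
    simp [Complex.mul_re, Complex.mul_im, (hg w).1, (hg w).2, (hh w).1, (hh w).2]
  have pow : ∀ g, good g → ∀ n : ℕ, good (g ^ n) := by
    intro g hg n
    induction n with
    | zero => simpa using one
    | succ n ih => rw [pow_succ]; exact mul _ _ ih hg
  have coord : ∀ i, good fun w => w i := fun i =>
    ⟨X (Sum.inl i), X (Sum.inr i), fun w => by simp [realCoords]⟩
  have coordConj : ∀ i, good fun w => starRingEnd ℂ (w i) := fun i =>
    ⟨X (Sum.inl i), -X (Sum.inr i), fun w => by simp [realCoords]⟩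
  have h : good (∏ i, (fun w => w i) ^ a i * (fun w => starRingEnd ℂ (w i)) ^ b i) :=
    Finset.prod_induction _ good mul one
      fun i _ => mul _ _ (pow _ (coord i) _) (pow _ (coordConj i) _)
  obtain ⟨p, q, h⟩ := h
  refine ⟨p, q, fun w => ?_⟩
  have := h w
  simpa [conjMonomial, Finset.prod_apply] using this

/-! ### Averages along orbits and separation by invariant monomials. -/

open Filter Topology in
/-- Cesàro averages of the powers of a unit complex number other than `1` tend to `0`. -/
theorem tendsto_average_pow_of_ne_one {c : ℂ} (hc : ‖c‖ = 1) (h1 : c ≠ 1) :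
    Tendsto (fun N : ℕ => (N : ℂ)⁻¹ * ∑ n ∈ Finset.range N, c ^ n) atTop (𝓝 0) := by
  refine squeeze_zero_norm (a := fun N : ℕ => (N : ℝ)⁻¹ * (2 / ‖c - 1‖)) (fun N => ?_) ?_
  · rw [norm_mul, norm_inv, Complex.norm_natCast, geom_sum_eq h1, norm_div]
    gcongr
    calc ‖c ^ N - 1‖ ≤ ‖c ^ N‖ + ‖(1 : ℂ)‖ := norm_sub_le _ _
      _ = 2 := by rw [norm_pow, hc]; norm_num
  · simpa using tendsto_inv_atTop_nhds_zero_nat (𝕜 := ℝ) |>.mul_const (2 / ‖c - 1‖)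

open Filter Topology in
/-- A continuous function on a polydisc has asymptotically equal averages along two orbits of a
diagonal unitary, provided the invariant monomials agree at the two starting points. -/
theorem tendsto_average_sub_of_conjMonomial_eq {d : ℕ} {v x y : Fin d → ℂ} (hv : ∀ i, ‖v i‖ = 1)
    (hxy : ∀ a b, conjMonomial a b v = 1 → conjMonomial a b x = conjMonomial a b y)
    {K : Set (Fin d → ℂ)} (hK : IsCompact K) (hx : ∀ n : ℕ, v ^ n * x ∈ K)
    (hy : ∀ n : ℕ, v ^ n * y ∈ K) (F : C(K, ℂ)) :
    Tendsto (fun N : ℕ => (N : ℂ)⁻¹ * ∑ n ∈ Finset.range N,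
      (F ⟨v ^ n * x, hx n⟩ - F ⟨v ^ n * y, hy n⟩)) atTop (𝓝 0) := by
  have : CompactSpace K := isCompact_iff_compactSpace.1 hK
  let avg : C(K, ℂ) → ℕ → ℂ := fun F N => (N : ℂ)⁻¹ * ∑ n ∈ Finset.range N,
      (F ⟨v ^ n * x, hx n⟩ - F ⟨v ^ n * y, hy n⟩)
  let coord : Fin d → C(K, ℂ) := fun i => ⟨fun w => w.1 i, (continuous_apply i).comp continuous_subtype_val⟩
  let s : Set C(K, ℂ) := Set.range coord
  have hmon : ∀ g ∈ Submonoid.closure (s ∪ star s), ∃ a b, ∀ w : K, g w = conjMonomial a b w.1 := by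
    intro g hg
    induction hg using Submonoid.closure_induction with
    | mem g hg =>
      rcases hg with ⟨i, rfl⟩ | ⟨i, hi⟩
      · refine ⟨Pi.single i 1, 0, fun w => ?_⟩
        simp [coord, conjMonomial, Pi.single_apply, pow_ite]
      · refine ⟨0, Pi.single i 1, fun w => ?_⟩
        rw [← star_star g, ← hi]
        simp [coord, conjMonomial, Pi.single_apply, pow_ite]
    | one => exact ⟨0, 0, fun w => by simp [conjMonomial]⟩
    | mul g h _ _ hg hh =>
      obtain ⟨a, b, hg⟩ := hg
      obtain ⟨a', b', hh⟩ := hh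
      exact ⟨a + a', b + b', fun w => by rw [conjMonomial_add, ContinuousMap.mul_apply, hg, hh]⟩
  have hspan : ∀ g ∈ Submodule.span ℂ (Submonoid.closure (s ∪ star s) : Set C(K, ℂ)),
      Tendsto (avg g) atTop (𝓝 0) := by
    intro g hg
    induction hg using Submodule.span_induction with
    | mem g hg =>
      obtain ⟨a, b, hg⟩ := hmon g hg
      have h : avg g = fun N : ℕ => ((N : ℂ)⁻¹ * ∑ n ∈ Finset.range N, conjMonomial a b v ^ n) *
          (conjMonomial a b x - conjMonomial a b y) := by
        funext N
        simp only [avg, hg, conjMonomial_mul, conjMonomial_pow, ← mul_sub, ← Finset.sum_mul,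
          mul_assoc]
      rw [h]
      -- Invariant monomials contribute zero by `hxy`; all others average out as geometric sums.
      by_cases hc : conjMonomial a b v = 1
      · simp [hxy a b hc]
      · simpa using (tendsto_average_pow_of_ne_one
          (norm_conjMonomial_of_norm_eq_one a b hv) hc).mul_const _
    | zero => simp [avg]
    | add g h _ _ hg hh =>
      have : avg (g + h) = fun N => avg g N + avg h N := by
        funext N
        simp only [avg, ContinuousMap.add_apply, ← mul_add, ← Finset.sum_add_distrib]
        congr 1
        exact Finset.sum_congr rfl fun n _ => by ring
      rw [this]
      simpa using hg.add hh
    | smul c g _ hg =>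
      have : avg (c • g) = fun N => c * avg g N := by
        funext N
        simp only [avg, ContinuousMap.smul_apply, smul_eq_mul, ← mul_sub, ← Finset.mul_sum]
        ring
      rw [this]
      simpa using hg.const_mul c
  have hsep : (StarAlgebra.adjoin ℂ s).SeparatesPoints := by
    intro w w' hne
    obtain ⟨i, hi⟩ : ∃ i, w.1 i ≠ w'.1 i := by
      by_contra! h
      exact hne (Subtype.ext (funext h))
    exact ⟨_, ⟨coord i, StarAlgebra.subset_adjoin ℂ s ⟨i, rfl⟩, rfl⟩, hi⟩
  have hdense := ContinuousMap.starSubalgebra_topologicalClosure_eq_top_of_separatesPoints _ hsep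
  have hF : F ∈ closure ((StarAlgebra.adjoin ℂ s : StarSubalgebra ℂ C(K, ℂ)) : Set C(K, ℂ)) := by
    rw [← StarSubalgebra.topologicalClosure_coe, hdense]
    trivial
  refine Metric.tendsto_atTop.2 fun ε hε => ?_
  -- Each summand of the average evaluates `F` twice, so an error of `ε / 4` costs `ε / 2`.
  obtain ⟨g, hg, hFg⟩ := Metric.mem_closure_iff.1 hF (ε / 4) (by positivity)
  have hg' : g ∈ Submodule.span ℂ (Submonoid.closure (s ∪ star s) : Set C(K, ℂ)) := by
    rw [← Algebra.adjoin_eq_span]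
    exact hg
  obtain ⟨M, hM⟩ := Metric.tendsto_atTop.1 (hspan g hg') (ε / 2) (by positivity)
  refine ⟨M, fun N hN => ?_⟩
  have h1 : dist (avg F N) (avg g N) ≤ ε / 2 := by
    have hpt : ∀ w, ‖F w - g w‖ ≤ ε / 4 := fun w => by
      rw [← dist_eq_norm]
      exact (ContinuousMap.dist_apply_le_dist w).trans hFg.le
    rw [dist_eq_norm]
    simp only [avg, ← mul_sub, ← Finset.sum_sub_distrib]
    rw [norm_mul, norm_inv, Complex.norm_natCast]
    have hs : ‖∑ n ∈ Finset.range N, ((F ⟨v ^ n * x, hx n⟩ - F ⟨v ^ n * y, hy n⟩) -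
        (g ⟨v ^ n * x, hx n⟩ - g ⟨v ^ n * y, hy n⟩))‖ ≤ N * (ε / 2) := by
      refine (norm_sum_le_of_le (Finset.range N) (f := fun n =>
        ((F ⟨v ^ n * x, hx n⟩ - F ⟨v ^ n * y, hy n⟩) -
        (g ⟨v ^ n * x, hx n⟩ - g ⟨v ^ n * y, hy n⟩))) (n := fun _ => ε / 2) fun n _ => ?_).trans
        (by simp)
      rw [sub_sub_sub_comm]
      linarith [norm_sub_le (F ⟨v ^ n * x, hx n⟩ - g ⟨v ^ n * x, hx n⟩)
        (F ⟨v ^ n * y, hy n⟩ - g ⟨v ^ n * y, hy n⟩), hpt ⟨v ^ n * x, hx n⟩, hpt ⟨v ^ n * y, hy n⟩]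
    rcases Nat.eq_zero_or_pos N with rfl | hN0
    · simp; positivity
    · have : (0 : ℝ) < N := by exact_mod_cast hN0
      rw [inv_mul_le_iff₀ this]
      exact hs
  have h2 := hM N hN
  calc dist (avg F N) 0 ≤ dist (avg F N) (avg g N) + dist (avg g N) 0 := dist_triangle _ _ _
    _ < ε := by linarith

theorem isometry_mul_left_of_norm_eq_one {d : ℕ} {v : Fin d → ℂ} (hv : ∀ i, ‖v i‖ = 1) :
    Isometry fun w : Fin d → ℂ => v * w := by
  refine Isometry.of_dist_eq fun w w' => ?_
  simp only [dist_pi_def, Pi.mul_apply]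
  congr 2
  funext i
  apply NNReal.eq
  simp [dist_eq_norm, ← mul_sub, hv]

theorem norm_pow_mul_of_norm_eq_one {d : ℕ} {v : Fin d → ℂ} (hv : ∀ i, ‖v i‖ = 1) (n : ℕ)
    (w : Fin d → ℂ) : ‖v ^ n * w‖ = ‖w‖ := by
  have h : ∀ i, ‖v i‖₊ = 1 := fun i => NNReal.eq (hv i)
  simp [Pi.norm_def, nnnorm_mul, h]

open Filter Topology in
/-- A point outside an orbit closure of a diagonal unitary is separated from the starting point by
an invariant monomial. -/
theorem exists_conjMonomial_ne_of_notMem_closure {d : ℕ} {v x y : Fin d → ℂ}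
    (hv : ∀ i, ‖v i‖ = 1) (hy : y ∉ closure (Set.range fun n : ℕ => v ^ n * x)) :
    ∃ a b, conjMonomial a b v = 1 ∧ conjMonomial a b x ≠ conjMonomial a b y := by
  by_contra! hxy
  set O : Set (Fin d → ℂ) := Set.range fun n : ℕ => v ^ n * x with hO
  have hOf : O = Set.range fun n : ℕ => (fun w => v * w)^[n] x := by
    simp [hO, mul_left_iterate]
  have hOb : Bornology.IsBounded O := by
    refine (Metric.isBounded_closedBall (x := 0) (r := ‖x‖)).subset ?_
    rintro _ ⟨n, rfl⟩
    simp [norm_pow_mul_of_norm_eq_one hv]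
  have hδ : 0 < Metric.infDist y O :=
    (Metric.infDist_pos_iff_notMem_closure (Set.range_nonempty _)).1 hy
  have hlow : ∀ n : ℕ, Metric.infDist y O ≤ Metric.infDist (v ^ n * y) O := fun n => by
    have := (isometry_mul_left_of_norm_eq_one hv).infDist_le_infDist_iterate y (hOf ▸ hOb) n
    rw [← hOf, mul_left_iterate] at this
    exact this
  set R := max ‖x‖ ‖y‖
  -- This test function vanishes along the orbit of `x` and stays at least `Metric.infDist y O`
  -- along that of `y`.
  let F : C(Metric.closedBall (0 : Fin d → ℂ) R, ℂ) :=
    ⟨fun w => (Metric.infDist w.1 O : ℂ), Complex.continuous_ofReal.comp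
      ((Metric.continuous_infDist_pt O).comp continuous_subtype_val)⟩
  have hlim := tendsto_average_sub_of_conjMonomial_eq hv hxy
    (isCompact_closedBall (0 : Fin d → ℂ) R)
    (fun n => by simp [norm_pow_mul_of_norm_eq_one hv, R])
    (fun n => by simp [norm_pow_mul_of_norm_eq_one hv, R]) F
  have hre := (Complex.continuous_re.tendsto _).comp hlim
  have hle : ∀ᶠ N : ℕ in atTop, (Complex.re ∘ fun N : ℕ => (N : ℂ)⁻¹ * ∑ n ∈ Finset.range N,
      ((Metric.infDist (v ^ n * x) O : ℂ) - (Metric.infDist (v ^ n * y) O : ℂ))) N ≤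
      -Metric.infDist y O := by
    filter_upwards [eventually_gt_atTop 0] with N hN
    have hN' : (0 : ℝ) < N := by exact_mod_cast hN
    have hz : ∀ n : ℕ, Metric.infDist (v ^ n * x) O = 0 := fun n =>
      Metric.infDist_zero_of_mem ⟨n, rfl⟩
    have hs : (N : ℝ) * Metric.infDist y O ≤
        ∑ n ∈ Finset.range N, Metric.infDist (v ^ n * y) O := by
      simpa using Finset.card_nsmul_le_sum (Finset.range N) _ _ fun n _ => hlow n
    have hcast : (N : ℂ)⁻¹ * ∑ n ∈ Finset.range N,
        ((Metric.infDist (v ^ n * x) O : ℂ) - (Metric.infDist (v ^ n * y) O : ℂ)) =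
        (((N : ℝ)⁻¹ * -∑ n ∈ Finset.range N, Metric.infDist (v ^ n * y) O : ℝ) : ℂ) := by
      simp [hz]
    rw [Function.comp_apply, hcast, Complex.ofReal_re, inv_mul_le_iff₀ hN']
    linarith
  have := le_of_tendsto hre hle
  simp only [Complex.zero_re] at this
  linarith

/-! ### From separating polynomials to invariants. -/

open MvPolynomial in
/-- A separating invariant integer polynomial yields a separating invariant half space. -/
theorem OrbitInstance.exists_isInvariant_of_aeval_lt {d : ℕ} (ℓ : OrbitInstance d)
    (p : MvPolynomial (Fin d ⊕ Fin d) ℤ)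
    (hp : ∀ w, aeval (realCoords (ℓ.A.mulVec w)) p = aeval (realCoords w) p)
    (hlt : aeval (realCoords ℓ.y) p < aeval (realCoords ℓ.x) p) :
    ∃ P : Set (Fin d → ℂ), IsComplexSemialgebraic P ∧ ℓ.IsInvariant P := by
  -- A rational threshold keeps the coefficients integral once its denominator is cleared.
  obtain ⟨q, hyq, hqx⟩ := exists_rat_btwn hlt
  have hden : (0 : ℝ) < q.den := by exact_mod_cast q.den_pos
  have hq : (q : ℝ) = q.num / q.den := by exact_mod_cast (Rat.num_div_den q).symm
  rw [hq, lt_div_iff₀ hden] at hyq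
  rw [hq, div_lt_iff₀ hden] at hqx
  have heval : ∀ u : Fin d ⊕ Fin d → ℝ, aeval u (C (q.den : ℤ) * p - C q.num) =
      (q.den : ℝ) * aeval u p - q.num := fun u => by
    simp
  refine ⟨_, ⟨_, IsSemialgebraic.pos (C (q.den : ℤ) * p - C q.num), rfl⟩, ?_, ?_, ?_⟩
  · rintro _ ⟨w, hw, rfl⟩
    simp only [Set.mem_preimage, Set.mem_ofPred_eq, heval, hp] at hw ⊢
    exact hw
  · simp only [Set.mem_preimage, Set.mem_ofPred_eq, heval]
    linarith
  · simp only [Set.mem_preimage, Set.mem_ofPred_eq, heval]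
    linarith

theorem OrbitInstance.exists_isInvariant_of_aeval_ne {d : ℕ} (ℓ : OrbitInstance d)
    (p : MvPolynomial (Fin d ⊕ Fin d) ℤ)
    (hp : ∀ w, MvPolynomial.aeval (realCoords (ℓ.A.mulVec w)) p =
      MvPolynomial.aeval (realCoords w) p)
    (hne : MvPolynomial.aeval (realCoords ℓ.x) p ≠ MvPolynomial.aeval (realCoords ℓ.y) p) :
    ∃ P : Set (Fin d → ℂ), IsComplexSemialgebraic P ∧ ℓ.IsInvariant P := by
  rcases lt_or_gt_of_ne hne with h | h
  · exact ℓ.exists_isInvariant_of_aeval_lt (-p) (by simpa using hp) (by simpa using h)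
  · exact ℓ.exists_isInvariant_of_aeval_lt p hp h

theorem corollary3p8 {d : ℕ} (ℓ : OrbitInstance d) (eig : Fin d → ℂ)
    (hA : ℓ.A = Matrix.diagonal eig) (heig : ∀ i, ‖eig i‖ = 1) :
    (∃ P : Set (Fin d → ℂ), IsComplexSemialgebraic P ∧ ℓ.IsInvariant P) ↔
      ℓ.y ∉ closure ℓ.orbit := by
  have hmulVec : ∀ w, ℓ.A.mulVec w = eig * w := fun w => by
    funext i
    simp [hA, Matrix.mulVec_diagonal]
  have horbit : ℓ.orbit = Set.range fun n : ℕ => eig ^ n * ℓ.x := by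
    unfold OrbitInstance.orbit
    congr 1
    funext n i
    simp [hA, Matrix.diagonal_pow, Matrix.mulVec_diagonal]
  constructor
  · rintro ⟨P, hP, hinv⟩ hy
    refine hinv.target_notMem (hP.closure_orbit_subset (f := fun w => eig * w)
      (isometry_mul_left_of_norm_eq_one heig) ?_ ?_ hinv.source_mem ?_ ?_)
    · intro w
      refine ⟨eig⁻¹ * w, funext fun i => ?_⟩
      have : eig i ≠ 0 := norm_ne_zero_iff.1 (by simp [heig])
      simp [this]
    · intro w hw
      exact hinv.image_subset ⟨w, hw, hmulVec w⟩
    · refine (Metric.isBounded_closedBall (x := 0) (r := ‖ℓ.x‖)).subset ?_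
      rintro _ ⟨n, rfl⟩
      simp [mul_left_iterate, norm_pow_mul_of_norm_eq_one heig]
    · simpa [horbit, mul_left_iterate] using hy
  · intro hy
    rw [horbit] at hy
    obtain ⟨a, b, h1, hne⟩ := exists_conjMonomial_ne_of_notMem_closure heig hy
    obtain ⟨p, q, hpq⟩ := exists_aeval_realCoords_eq_conjMonomial a b
    have hinv : ∀ w, conjMonomial a b (ℓ.A.mulVec w) = conjMonomial a b w := fun w => by
      rw [hmulVec, conjMonomial_mul, h1, one_mul]
    by_cases hre : (conjMonomial a b ℓ.x).re = (conjMonomial a b ℓ.y).re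
    · refine ℓ.exists_isInvariant_of_aeval_ne q (fun w => ?_) fun him => hne (Complex.ext hre ?_)
      · rw [← (hpq _).2, ← (hpq _).2, hinv]
      · rw [(hpq _).2, (hpq _).2, him]
    · refine ℓ.exists_isInvariant_of_aeval_ne p (fun w => ?_) fun h => hre ?_
      · rw [← (hpq _).1, ← (hpq _).1, hinv]
      · rw [(hpq _).1, (hpq _).1, h]
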